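/- Let $G$ be a countable discrete group. A $G$-sequence is a function $p:\mathbb{Z}\to G$; the $G$-sequences form a group $G^{\mathbb{Z}}$ under pointwise multiplication, with identity $e$, and $\iota:G\to G^{\mathbb{Z}}$ denotes the embedding as constant functions. A $G$-system is a finite tuple $\mathbf{p}=(p_1,\ldots,p_k)$ of $G$-sequences; it is trivial if all its entries are constant. For $G$-sequences $p,q$ let $\langle p|q\rangle:\mathbb{Z}\to G^{\mathbb{Z}}$ be given by \[\langle p|q\rangle(n)=\big(q(n+m)\,p(n+m)^{-1}\,p(n)\big)_{m\in\mathbb{Z}}.\] For $k\ge 1$ the reduction of $\mathbf{p}$ is the $G^{\mathbb{Z}}$-system \[\mathbf{p}^\ast=(\iota\circ p_1,\ldots,\iota\circ p_{k-1},\langle p_k|e\rangle,\langle p_k|p_1\rangle,\ldots,\langle p_k|p_{k-1}\rangle).\] (These notions are used for arbitrary groups, so that reductions can be iterated.) A system has finite complexity if it can be converted into a trivial system by a finite sequence of operations, each of which is a reduction, a re-ordering of the entries, or a removal of duplicated entries. Theorem. Let $G$ be a countable discrete group, let $T:G\curvearrowright(X,\mu)$ be an action by $\mu$-preserving homeomorphisms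 on a compact metric space $X$ with a Borel probability measure $\mu$, let $\mathbf{p}=(p_1,\ldots,p_k)$ be a $G$-system of finite complexity, and let $f_1,\ldots,f_k\in L^\infty(\mu)$ (real- or complex-valued). Then the averages \[\frac1N\sum_{n=1}^N (f_1\circ T^{p_1(n)})(f_2\circ T^{p_2(n)})\cdots(f_k\circ T^{p_k(n)})\] converge in $L^2(\mu)$ as $N\to\infty$. -/

import Mathlib

open MeasureTheory Filter
open scoped ENNReal Topology

universe u

/-- A `G`-sequence is a function `ℤ → G`; the `G`-sequences form a group under coordinate-wise
operations. -/
abbrev GSequence (G : Type u) : Type u := ℤ → G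

/-- A `G`-system of length `k` is a `k`-tuple of `G`-sequences. -/
abbrev GSystem (G : Type u) (k : ℕ) : Type u := Fin k → GSequence G

namespace GSequence

variable {G : Type u}

/-- The embedding of `G` in `G^ℤ` as the constant functions. -/
def const (g : G) : GSequence G := fun _ => g

variable [Group G]

/-- `D_m p (n) = p(n+m)⁻¹ p(n)`. -/
def diff (m : ℤ) (p : GSequence G) : GSequence G := fun n => (p (n + m))⁻¹ * p n

/-- The bracket `⟨p|q⟩ : ℤ → G^ℤ`, whose value at `n` is the sequence
`m ↦ ⟨p|q⟩_m(n) = q(n+m) · D_m p (n)`. -/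
def bracket (p q : GSequence G) : GSequence (GSequence G) :=
  fun n m => q (n + m) * diff m p n

end GSequence

namespace GSystem

/-- A system is trivial if all its entries are constant. -/
def IsTrivial {G : Type u} {k : ℕ} (p : GSystem G k) : Prop :=
  ∀ i, ∃ g : G, p i = GSequence.const g

/-- The reduction of the `G`-system `(p₁, …, p_{k+1})`: the `G^ℤ`-system
`(ι ∘ p₁, …, ι ∘ p_k, ⟨p_{k+1}|e⟩, ⟨p_{k+1}|p₁⟩, …, ⟨p_{k+1}|p_k⟩)`. -/
def reduction {G : Type u} [Group G] {k : ℕ} (p : GSystem G (k + 1)) :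
    GSystem (GSequence G) (k + (k + 1)) :=
  Fin.append
    (fun i : Fin k => fun n => GSequence.const (p i.castSucc n))
    (Fin.cons (GSequence.bracket (p (Fin.last k)) 1)
      (fun i : Fin k => GSequence.bracket (p (Fin.last k)) (p i.castSucc)))

/-- A system has finite complexity if finitely many operations, each of which is a re-ordering,
the removal of a duplicated entry, or a reduction (which replaces the group `G` by `G^ℤ`), convert
it into a trivial system. -/
inductive FiniteComplexity : ∀ {G : Type u} [Group G] {k : ℕ}, GSystem G k → Prop
  | trivial {G : Type u} [Group G] {k : ℕ} (p : GSystem G k) (hp : IsTrivial p) :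
      FiniteComplexity p
  | reorder {G : Type u} [Group G] {k : ℕ} (p : GSystem G k) (σ : Equiv.Perm (Fin k))
      (h : FiniteComplexity (fun i => p (σ i))) : FiniteComplexity p
  | removeDuplicate {G : Type u} [Group G] {k : ℕ} (p : GSystem G (k + 1)) (i j : Fin (k + 1))
      (hij : i ≠ j) (hp : p i = p j) (h : FiniteComplexity (fun l : Fin k => p (j.succAbove l))) :
      FiniteComplexity p
  | reduce {G : Type u} [Group G] {k : ℕ} (p : GSystem G (k + 1))
      (h : FiniteComplexity (reduction p)) : FiniteComplexity p

end GSystem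

/-!
The averages are studied on a class of systems that is closed under reduction: a set `Ω` with a
`G`-action, an invariant algebra of bounded real functions on it and an invariant positive linear
functional (`MeanAlgebra`). The claim that all averages are Cauchy in the associated `L²` seminorm
passes from the reduction of a system `p` to `p` itself, as follows.

Fix all functions but the last and let `T_N u` be the `N`-th average with last function `u`. The
adjoint `T_M*` is again given by averages, and a shift of its averaging variable `m` by `n` rewrites
`T_N (T_M* a)`, up to `O(N / M)`, as the mean over `m ≤ M` of an `N`-th average along the `m`-th
coordinate of the reduction (`MeanAlgebra.abs_averageOp_averageAdj_sub_le`). With `a = T_M u`, the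
average over `m` and then the limit of `M` along an ultrafilter make the families indexed by `(M, m)`
a `MeanAlgebra` over the group `G^ℤ` (`MeanAlgebra.fibered`), to which the inductive hypothesis
applies. So `T_N (T_M* T_M u)` is Cauchy in `N`, uniformly in `M` along the ultrafilter. By a Hilbert
space argument (`cauchySeq_of_adjoint_comp`) this is enough: the vectors `z` for which `T_N z` is
Cauchy form a closed subspace containing all weak limits of `T_M* T_M u`, while
`‖T_M z‖² = ⟪T_M* T_M z, z⟫` tends to zero when `z` is orthogonal to these limits. The argument takes
place in the completion of the algebra.

For an invariant measure the bounded measurable functions form a `MeanAlgebra`. Completeness of `L²`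
gives the limits, and functions with values in `𝕜` are expanded into real and imaginary parts.
-/

/-! ### A convergence criterion in Hilbert space -/

theorem Ultrafilter.exists_tendsto_of_abs_le {ι : Type*} (U : Ultrafilter ι) {a : ι → ℝ} {C : ℝ}
    (h : ∀ i, |a i| ≤ C) : ∃ l, Tendsto a U (𝓝 l) := by
  have hmem : (U.map a : Filter ℝ) ≤ 𝓟 (Set.Icc (-C) C) :=
    le_principal_iff.2 (Filter.mem_map.2 (Filter.univ_mem' fun i => abs_le.1 (h i)))
  obtain ⟨l, -, hl⟩ := isCompact_Icc.ultrafilter_le_nhds (U.map a) hmem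
  exact ⟨l, hl⟩

section Hilbert

open scoped InnerProductSpace

variable {H : Type*} [NormedAddCommGroup H] [InnerProductSpace ℝ H] [CompleteSpace H]

/-- Bounded families in a Hilbert space converge weakly along ultrafilters. -/
theorem Ultrafilter.exists_tendsto_inner {ι : Type*} (U : Ultrafilter ι) {v : ι → H} {C : ℝ}
    (h : ∀ i, ‖v i‖ ≤ C) : ∃ q : H, ∀ z, Tendsto (fun i => ⟪v i, z⟫_ℝ) U (𝓝 ⟪q, z⟫_ℝ) := by
  have hb : ∀ z i, |⟪v i, z⟫_ℝ| ≤ C * ‖z‖ := fun z i =>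
    (abs_real_inner_le_norm _ _).trans (by gcongr; exact h i)
  choose l hl using fun z => U.exists_tendsto_of_abs_le (hb z)
  let L : H →ₗ[ℝ] ℝ :=
    { toFun := l
      map_add' := fun x y => tendsto_nhds_unique (hl (x + y)) <| by
        simpa only [inner_add_right] using (hl x).add (hl y)
      map_smul' := fun c x => tendsto_nhds_unique (hl (c • x)) <| by
        simpa only [inner_smul_right, RingHom.id_apply, smul_eq_mul] using (hl x).const_mul c }
  let L' : H →L[ℝ] ℝ := L.mkContinuous C fun z =>
    le_of_tendsto (hl z).norm (Eventually.of_forall fun i => hb z i)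
  refine ⟨(InnerProductSpace.toDual ℝ H).symm L', fun z => ?_⟩
  rw [InnerProductSpace.toDual_symm_apply]
  exact hl z

/-- If `Tₙ (T_M* T_M h)` is Cauchy in `n`, uniformly in `M` along every nonprincipal ultrafilter,
then `Tₙ z` is Cauchy for every `z`: the vectors `z` with `Tₙ z` Cauchy form a closed subspace which
contains the weak limits of `T_M* T_M h`, and a vector `z` orthogonal to all these weak limits
satisfies `‖T_M z‖² = ⟪T_M* T_M z, z⟫ → 0`. -/
theorem cauchySeq_of_adjoint_comp (T : ℕ → H →L[ℝ] H) {C : ℝ} (hT : ∀ n, ‖T n‖ ≤ C)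
    {D : Set H} (hD : Dense D)
    (hTT : ∀ U : Ultrafilter ℕ, (U : Filter ℕ) ≤ atTop → ∀ h ∈ D, ∀ ε > 0, ∃ N₀, ∀ N ≥ N₀,
      ∀ N' ≥ N₀, ∀ᶠ M in (U : Filter ℕ),
        ‖(T N - T N') ((T M).adjoint (T M h))‖ ≤ ε) (z : H) :
    CauchySeq fun n => T n z := by
  have hC : 0 ≤ C := (norm_nonneg _).trans (hT 0)
  have hTz : ∀ n z, ‖T n z‖ ≤ C * ‖z‖ := fun n z => (T n).le_of_opNorm_le (hT n) z
  let S : Submodule ℝ H :=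
    { carrier := {z | CauchySeq fun n => T n z}
      add_mem' := fun {x y} hx hy => by
        simpa only [Set.mem_ofPred_eq, map_add, Pi.add_def] using CauchySeq.add hx hy
      zero_mem' := by simpa using cauchySeq_const (0 : H)
      smul_mem' := fun c x hx => by
        simpa only [Set.mem_ofPred_eq, map_smul, Function.comp_def] using
          (uniformContinuous_const_smul c).comp_cauchySeq hx }
  have hS : ∀ z, z ∈ S ↔ CauchySeq fun n => T n z := fun _ => Iff.rfl
  have hclosed : IsClosed (S : Set H) := by
    refine isClosed_of_closure_subset fun z hz => ?_
    refine Metric.cauchySeq_iff'.2 fun ε hε => ?_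
    obtain ⟨y, hy, hyz⟩ := Metric.mem_closure_iff.1 hz (ε / (4 * (C + 1))) (by positivity)
    obtain ⟨N₀, hN₀⟩ := Metric.cauchySeq_iff'.1 ((hS y).1 hy) (ε / 4) (by positivity)
    refine ⟨N₀, fun n hn => ?_⟩
    have h1 : ∀ n, dist (T n z) (T n y) ≤ ε / 4 := fun n => by
      rw [dist_eq_norm, ← map_sub]
      rw [dist_eq_norm] at hyz
      calc ‖T n (z - y)‖ ≤ C * ‖z - y‖ := hTz _ _
        _ ≤ (C + 1) * (ε / (4 * (C + 1))) := by gcongr; linarith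
        _ = ε / 4 := by field_simp
    have h2 := hN₀ n hn
    calc dist (T n z) (T N₀ z)
        ≤ dist (T n z) (T n y) + dist (T n y) (T N₀ y) + dist (T N₀ y) (T N₀ z) :=
          dist_triangle4 _ _ _ _
      _ < ε := by
          have h3 := h1 N₀
          rw [dist_comm] at h3
          linarith [h1 n]
  have hweak : ∀ U : Ultrafilter ℕ, (U : Filter ℕ) ≤ atTop → ∀ h ∈ D, ∀ q : H,
      (∀ z, Tendsto (fun M => ⟪(T M).adjoint (T M h), z⟫_ℝ) U (𝓝 ⟪q, z⟫_ℝ)) → q ∈ S := by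
    intro U hU h hh q hq
    refine (hS q).2 (Metric.cauchySeq_iff'.2 fun ε hε => ?_)
    obtain ⟨N₀, hN₀⟩ := hTT U hU h hh (ε / 2) (by positivity)
    refine ⟨N₀, fun N hN => ?_⟩
    set A := T N - T N₀ with hA
    -- the norm is weakly lower semicontinuous
    have hle : ‖A q‖ * ‖A q‖ ≤ ‖A q‖ * (ε / 2) := by
      have h1 := hq (A.adjoint (A q))
      simp only [ContinuousLinearMap.adjoint_inner_right, real_inner_self_eq_norm_mul_norm] at h1
      refine le_of_tendsto h1 ((hN₀ N hN N₀ le_rfl).mono fun M hM => ?_)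
      refine (real_inner_le_norm _ _).trans ?_
      rw [mul_comm]
      gcongr
    have : ‖A q‖ ≤ ε / 2 := by
      rcases (norm_nonneg (A q)).eq_or_lt with h0 | h0
      · rw [← h0]; positivity
      · exact le_of_mul_le_mul_left hle h0
    rw [dist_eq_norm]
    change ‖A q‖ < ε
    linarith
  have horth : Sᗮ = ⊥ := by
    refine (Submodule.eq_bot_iff _).2 fun z hz => ?_
    have hlim : Tendsto (fun n => T n z) atTop (𝓝 0) := by
      refine tendsto_iff_ultrafilter _ _ _ |>.2 fun U hU => ?_
      refine Metric.tendsto_nhds.2 fun ε hε => ?_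
      obtain ⟨h, hh, hhz⟩ := hD.exists_dist_lt z (ε := ε ^ 2 / (2 * (C * C * ‖z‖ + 1)))
        (by positivity)
      obtain ⟨q, hq⟩ := U.exists_tendsto_inner (v := fun M => (T M).adjoint (T M h))
        (C := C * (C * ‖h‖)) fun M => by
          refine ((T M).adjoint.le_of_opNorm_le (c := C) ?_ _).trans ?_
          · rw [LinearIsometryEquiv.norm_map]; exact hT M
          · gcongr; exact hTz M h
      have hqz : ⟪q, z⟫_ℝ = 0 := Submodule.inner_right_of_mem_orthogonal (hweak U hU h hh q hq) hz
      have h1 := hq z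
      rw [hqz] at h1
      filter_upwards [Metric.tendsto_nhds.1 h1 (ε ^ 2 / 2) (by positivity)] with M hM
      rw [dist_zero_right] at hM ⊢
      rw [ContinuousLinearMap.adjoint_inner_left, Real.norm_eq_abs] at hM
      have h2 : ‖T M z‖ ^ 2 = ⟪T M h, T M z⟫_ℝ + ⟪T M (z - h), T M z⟫_ℝ := by
        rw [← inner_add_left, ← map_add, add_sub_cancel, real_inner_self_eq_norm_sq]
      have h3 : ⟪T M (z - h), T M z⟫_ℝ ≤ ε ^ 2 / 2 := by
        rw [dist_eq_norm] at hhz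
        calc ⟪T M (z - h), T M z⟫_ℝ ≤ ‖T M (z - h)‖ * ‖T M z‖ := real_inner_le_norm _ _
          _ ≤ (C * ‖z - h‖) * (C * ‖z‖) := by gcongr <;> exact hTz _ _
          _ = ‖z - h‖ * (C * C * ‖z‖) := by ring
          _ ≤ (ε ^ 2 / (2 * (C * C * ‖z‖ + 1))) * (C * C * ‖z‖ + 1) := by
              gcongr; linarith
          _ = ε ^ 2 / 2 := by field_simp
      have h4 := le_abs_self ⟪T M h, T M z⟫_ℝ
      exact lt_of_pow_lt_pow_left₀ 2 hε.le (by linarith)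
    have hzS : z ∈ S := (hS z).2 hlim.cauchySeq
    have h0 := Submodule.inner_right_of_mem_orthogonal hzS hz
    exact inner_self_eq_zero.1 h0
  have : CompleteSpace S := hclosed.completeSpace_coe
  have htop : S = ⊤ := (Submodule.orthogonal_eq_bot_iff).1 horth
  exact (hS z).1 (htop ▸ Submodule.mem_top)

end Hilbert

/-- The same criterion for a positive semidefinite form on a space that need not be complete, with
operators `S M` that are adjoint to the `T M`. -/
theorem cauchy_of_adjoint_comp {E : Type*} [AddCommGroup E] [Module ℝ E]
    (B : LinearMap.BilinForm ℝ E) (hsymm : ∀ x y, B x y = B y x) (hpos : ∀ x, 0 ≤ B x x)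
    (T S : ℕ → E →ₗ[ℝ] E) (hadj : ∀ n x y, B (T n x) y = B x (S n y))
    {C : ℝ} (hC : 0 ≤ C) (hT : ∀ n x, B (T n x) (T n x) ≤ C ^ 2 * B x x)
    (hTS : ∀ U : Ultrafilter ℕ, (U : Filter ℕ) ≤ atTop → ∀ x, ∀ ε > 0, ∃ N₀, ∀ N ≥ N₀, ∀ N' ≥ N₀,
      ∀ᶠ M in (U : Filter ℕ),
        B ((T N - T N') (S M (T M x))) ((T N - T N') (S M (T M x))) ≤ ε)
    (x : E) : ∀ ε > 0, ∃ N₀, ∀ N ≥ N₀, ∀ N' ≥ N₀,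
      B (T N x - T N' x) (T N x - T N' x) ≤ ε := by
  let core : PreInnerProductSpace.Core ℝ E :=
    { inner := fun x y => B x y
      conj_inner_symm := fun x y => hsymm y x
      re_inner_nonneg := hpos
      add_left := fun x y z => by simp
      smul_left := fun x y r => by simp }
  let : SeminormedAddCommGroup E := InnerProductSpace.Core.toSeminormedAddCommGroup (𝕜 := ℝ) (c := core)
  let : InnerProductSpace ℝ E := InnerProductSpace.ofCore core
  have hinner : ∀ x y : E, inner ℝ x y = B x y := fun _ _ => rfl
  have hnorm : ∀ x : E, ‖x‖ ^ 2 = B x x := fun x => by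
    rw [← real_inner_self_eq_norm_sq, hinner]
  have hTn : ∀ n x, ‖T n x‖ ≤ C * ‖x‖ := fun n x => by
    refine le_of_sq_le_sq ?_ (by positivity)
    rw [mul_pow, hnorm, hnorm]
    exact hT n x
  let T₁ : ℕ → E →L[ℝ] E := fun n => (T n).mkContinuous C (hTn n)
  let T' : ℕ → UniformSpace.Completion E →L[ℝ] UniformSpace.Completion E := fun n =>
    (T₁ n).completion
  have hT'coe : ∀ n (x : E), T' n x = (T n x : E) := fun n x => by
    simp [T', T₁]
  have hT' : ∀ n, ‖T' n‖ ≤ C := fun n => by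
    refine ContinuousLinearMap.opNorm_le_bound _ hC fun z => ?_
    refine UniformSpace.Completion.induction_on z
      (isClosed_le (by fun_prop) (by fun_prop)) fun x => ?_
    rw [hT'coe, UniformSpace.Completion.norm_coe, UniformSpace.Completion.norm_coe]
    exact hTn n x
  have hS' : ∀ n (y : E), (T' n).adjoint y = (S n y : E) := fun n y => by
    refine ext_inner_right ℝ fun z => ?_
    rw [ContinuousLinearMap.adjoint_inner_left]
    refine UniformSpace.Completion.induction_on z
      (isClosed_eq (by fun_prop) (by fun_prop)) fun x => ?_
    rw [hT'coe, UniformSpace.Completion.inner_coe, UniformSpace.Completion.inner_coe, hinner,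
      hinner, hsymm, hadj, hsymm]
  have hcoe : ∀ N N' (y : E), ‖(T' N - T' N') (y : UniformSpace.Completion E)‖ ^ 2
      = B ((T N - T N') y) ((T N - T N') y) := fun N N' y => by
    rw [sub_apply, hT'coe, hT'coe, ← UniformSpace.Completion.coe_sub,
      UniformSpace.Completion.norm_coe, hnorm, LinearMap.sub_apply]
  have key := cauchySeq_of_adjoint_comp T' hT'
    (D := Set.range ((↑) : E → UniformSpace.Completion E))
    UniformSpace.Completion.denseRange_coe (by
      rintro U hU _ ⟨h, rfl⟩ ε hε
      obtain ⟨N₀, hN₀⟩ := hTS U hU h (ε ^ 2) (by positivity)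
      refine ⟨N₀, fun N hN N' hN' => (hN₀ N hN N' hN').mono fun M hM => ?_⟩
      refine le_of_sq_le_sq ?_ hε.le
      rw [hT'coe, hS', hcoe]
      exact hM) x
  intro ε hε
  obtain ⟨N₀, hN₀⟩ := Metric.cauchySeq_iff.1 key (Real.sqrt ε) (Real.sqrt_pos.2 hε)
  refine ⟨N₀, fun N hN N' hN' => ?_⟩
  have h := (hN₀ N hN N' hN').le
  rw [dist_eq_norm, ← sub_apply] at h
  have h2 := pow_le_pow_left₀ (norm_nonneg _) h 2
  rwa [hcoe, Real.sq_sqrt hε.le] at h2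

theorem abs_inv_mul_sum_Icc_le {N : ℕ} {a : ℕ → ℝ} {C : ℝ} (hC : 0 ≤ C)
    (h : ∀ n ∈ Finset.Icc 1 N, |a n| ≤ C) : |(N : ℝ)⁻¹ * ∑ n ∈ Finset.Icc 1 N, a n| ≤ C := by
  rcases N.eq_zero_or_pos with rfl | hN
  · simpa using hC
  · have hN' : (0 : ℝ) < N := by exact_mod_cast hN
    have h1 := (Finset.abs_sum_le_sum_abs a (Finset.Icc 1 N)).trans
      (Finset.sum_le_card_nsmul _ _ _ h)
    rw [Nat.card_Icc, Nat.add_sub_cancel, nsmul_eq_mul] at h1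
    rw [abs_mul, abs_of_pos (inv_pos.2 hN'), inv_mul_le_iff₀ hN']
    exact h1

/-! ### Algebras of bounded functions with an invariant mean -/

/-- A `G`-invariant unital algebra of bounded real functions on a `G`-set `Ω`, with a positive
`G`-invariant linear functional on it. The functional need not be given by a measure. -/
structure MeanAlgebra (G : Type*) [Group G] (Ω : Type*) [MulAction G Ω] where
  /-- The algebra of functions. -/
  alg : Subalgebra ℝ (Ω → ℝ)
  bounded : ∀ f ∈ alg, ∃ C, ∀ x, |f x| ≤ C
  smul_mem : ∀ (g : G), ∀ f ∈ alg, (fun x => f (g • x)) ∈ alg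
  /-- The invariant functional. -/
  mean : alg →ₗ[ℝ] ℝ
  mean_nonneg : ∀ f : alg, (∀ x, 0 ≤ f.1 x) → 0 ≤ mean f
  mean_smul : ∀ (g : G) (f : alg), mean ⟨fun x => f.1 (g • x), smul_mem g f.1 f.2⟩ = mean f

namespace MeanAlgebra

section Basic

variable {G : Type*} [Group G] {Ω : Type*} [MulAction G Ω] (A : MeanAlgebra G Ω)

/-- The action of `g : G` on the algebra, `f ↦ f ∘ g`. This is a right action of `G`. -/
def translate (g : G) : A.alg →ₐ[ℝ] A.alg where
  toFun f := ⟨fun x => f.1 (g • x), A.smul_mem g f.1 f.2⟩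
  map_one' := rfl
  map_mul' _ _ := rfl
  map_zero' := rfl
  map_add' _ _ := rfl
  commutes' _ := rfl

@[simp]
theorem translate_apply (g : G) (f : A.alg) (x : Ω) : (A.translate g f).1 x = f.1 (g • x) := rfl

theorem translate_translate (g h : G) (f : A.alg) :
    A.translate h (A.translate g f) = A.translate (g * h) f := by
  ext x
  simp [mul_smul]

theorem translate_one (f : A.alg) : A.translate 1 f = f := by
  ext x
  simp

@[simp]
theorem mean_translate (g : G) (f : A.alg) : A.mean (A.translate g f) = A.mean f :=
  A.mean_smul g f

theorem mean_mono {f g : A.alg} (h : ∀ x, f.1 x ≤ g.1 x) : A.mean f ≤ A.mean g := by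
  have := A.mean_nonneg (g - f) fun x => by simpa using h x
  rw [map_sub] at this
  linarith

theorem mean_one_nonneg : 0 ≤ A.mean 1 := A.mean_nonneg 1 fun _ => zero_le_one

theorem mean_le {f : A.alg} {C : ℝ} (h : ∀ x, f.1 x ≤ C) : A.mean f ≤ C * A.mean 1 := by
  rw [← smul_eq_mul, ← map_smul]
  exact A.mean_mono fun x => by simpa using h x

theorem abs_mean_le {f : A.alg} {C : ℝ} (h : ∀ x, |f.1 x| ≤ C) : |A.mean f| ≤ C * A.mean 1 := by
  refine abs_le'.2 ⟨A.mean_le fun x => (le_abs_self _).trans (h x), ?_⟩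
  rw [← map_neg]
  exact A.mean_le fun x => (neg_le_abs _).trans (h x)

/-- The semi-inner product `(f, g) ↦ mean (f g)`. -/
def form : LinearMap.BilinForm ℝ A.alg := (LinearMap.mul ℝ A.alg).compr₂ A.mean

theorem form_apply (f g : A.alg) : A.form f g = A.mean (f * g) := rfl

theorem form_self_nonneg (f : A.alg) : 0 ≤ A.form f f :=
  A.mean_nonneg _ fun x => mul_self_nonneg (f.1 x)

theorem form_self_le {f : A.alg} {C : ℝ} (h : ∀ x, |f.1 x| ≤ C) :
    A.form f f ≤ C ^ 2 * A.mean 1 :=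
  A.mean_le fun x => by
    have := pow_le_pow_left₀ (abs_nonneg _) (h x) 2
    rw [sq_abs, sq] at this
    exact this

theorem form_add_self_le (f g : A.alg) :
    A.form (f + g) (f + g) ≤ 2 * A.form f f + 2 * A.form g g := by
  have h := A.form_self_nonneg (f - g)
  simp only [map_add, map_sub, LinearMap.add_apply, LinearMap.sub_apply] at h ⊢
  linarith

theorem form_mul_self_le {f : A.alg} {C : ℝ} (h : ∀ x, |f.1 x| ≤ C) (g : A.alg) :
    A.form (f * g) (f * g) ≤ C ^ 2 * A.form g g := by
  rw [form_apply, form_apply, ← smul_eq_mul (C ^ 2), ← map_smul]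
  refine A.mean_mono fun x => ?_
  have h1 : (f.1 x) ^ 2 ≤ C ^ 2 := by
    rw [← sq_abs]
    exact pow_le_pow_left₀ (abs_nonneg _) (h x) 2
  have h2 := mul_le_mul_of_nonneg_right h1 (mul_self_nonneg (g.1 x))
  simp only [Subalgebra.coe_mul, Subalgebra.coe_smul, Pi.mul_apply, Pi.smul_apply, smul_eq_mul]
  linarith

theorem form_translate_self (g : G) (f : A.alg) :
    A.form (A.translate g f) (A.translate g f) = A.form f f := by
  rw [form_apply, form_apply, ← map_mul, mean_translate]

theorem coe_sum_apply {ι : Type*} (s : Finset ι) (g : ι → A.alg) (x : Ω) :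
    (∑ i ∈ s, g i).1 x = ∑ i ∈ s, (g i).1 x := by
  have h := AddSubmonoidClass.coe_finsetSum g s
  have h' := congrFun h x
  rwa [Finset.sum_apply] at h'

theorem coe_prod_apply {ι : Type*} (s : Finset ι) (g : ι → A.alg) (x : Ω) :
    (∏ i ∈ s, g i).1 x = ∏ i ∈ s, (g i).1 x := by
  have h := SubmonoidClass.coe_finsetProd g s
  have h' := congrFun h x
  rwa [Finset.prod_apply] at h'

theorem form_average_self_le (N : ℕ) (g : ℕ → A.alg) :
    A.form ((N : ℝ)⁻¹ • ∑ n ∈ Finset.Icc 1 N, g n) ((N : ℝ)⁻¹ • ∑ n ∈ Finset.Icc 1 N, g n)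
      ≤ (N : ℝ)⁻¹ * ∑ n ∈ Finset.Icc 1 N, A.form (g n) (g n) := by
  have h : (N : ℝ)⁻¹ * ∑ n ∈ Finset.Icc 1 N, A.form (g n) (g n)
      = A.mean ((N : ℝ)⁻¹ • ∑ n ∈ Finset.Icc 1 N, g n * g n) := by
    simp [form_apply]
  rw [h, form_apply]
  refine A.mean_mono fun x => ?_
  have h1 := sq_sum_le_card_mul_sum_sq (s := Finset.Icc 1 N) (f := fun n => (g n).1 x)
  rw [Nat.card_Icc, Nat.add_sub_cancel] at h1
  simp only [Subalgebra.coe_mul, Subalgebra.coe_smul, Pi.mul_apply, Pi.smul_apply, smul_eq_mul,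
    coe_sum_apply]
  simp only [← sq]
  rcases N.eq_zero_or_pos with rfl | hN
  · simp
  · have hN' : (0 : ℝ) < N := by exact_mod_cast hN
    calc ((N : ℝ)⁻¹ * ∑ n ∈ Finset.Icc 1 N, (g n).1 x) ^ 2
        = ((N : ℝ)⁻¹) ^ 2 * (∑ n ∈ Finset.Icc 1 N, (g n).1 x) ^ 2 := by ring
      _ ≤ ((N : ℝ)⁻¹) ^ 2 * (N * ∑ n ∈ Finset.Icc 1 N, (g n).1 x ^ 2) := by gcongr
      _ = (N : ℝ)⁻¹ * ∑ n ∈ Finset.Icc 1 N, (g n).1 x ^ 2 := by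
          rw [sq, mul_assoc, inv_mul_cancel_left₀ hN'.ne']

/-- The averages `N⁻¹ ∑_{n=1}^N ∏ᵢ fᵢ ∘ pᵢ(n)`. -/
noncomputable def average {k : ℕ} (p : GSystem G k) (f : Fin k → A.alg) (N : ℕ) : A.alg :=
  (N : ℝ)⁻¹ • ∑ n ∈ Finset.Icc 1 N, ∏ i, A.translate (p i (n : ℤ)) (f i)

theorem average_apply {k : ℕ} (p : GSystem G k) (f : Fin k → A.alg) (N : ℕ) (x : Ω) :
    (A.average p f N).1 x
      = (N : ℝ)⁻¹ * ∑ n ∈ Finset.Icc 1 N, ∏ i, (f i).1 (p i (n : ℤ) • x) := by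
  simp [average]

end Basic

/-- The set `ℕ × ℤ × Ω`, on which `G^ℤ` acts on the fibre over `(M, m)` through the `m`-th
coordinate. -/
def Fibered (Ω : Type*) : Type _ := ℕ × ℤ × Ω

instance {G : Type*} [Group G] {Ω : Type*} [MulAction G Ω] :
    MulAction (GSequence G) (Fibered Ω) where
  smul g z := (z.1, z.2.1, g z.2.1 • z.2.2)
  one_smul z := by
    change (z.1, z.2.1, (1 : G) • z.2.2) = z
    rw [one_smul]
    rfl
  mul_smul g h z := by
    change (z.1, z.2.1, (g z.2.1 * h z.2.1) • z.2.2) = _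
    rw [mul_smul]
    rfl

section Fibered

variable {G : Type*} [Group G] {Ω : Type*} [MulAction G Ω] (A : MeanAlgebra G Ω)

/-- The uniformly bounded families, indexed by `ℕ × ℤ`, of elements of the algebra. -/
def fiberedAlg : Subalgebra ℝ (Fibered Ω → ℝ) where
  carrier := {F | (∃ C, ∀ z, |F z| ≤ C) ∧ ∀ M m, (fun x => F (M, m, x)) ∈ A.alg}
  mul_mem' := by
    rintro F F' ⟨⟨C, hC⟩, hF⟩ ⟨⟨C', hC'⟩, hF'⟩
    refine ⟨⟨C * C', fun z => ?_⟩, fun M m => A.alg.mul_mem (hF M m) (hF' M m)⟩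
    rw [Pi.mul_apply, abs_mul]
    exact mul_le_mul (hC z) (hC' z) (abs_nonneg _) ((abs_nonneg _).trans (hC z))
  add_mem' := by
    rintro F F' ⟨⟨C, hC⟩, hF⟩ ⟨⟨C', hC'⟩, hF'⟩
    exact ⟨⟨C + C', fun z => (abs_add_le _ _).trans (add_le_add (hC z) (hC' z))⟩,
      fun M m => A.alg.add_mem (hF M m) (hF' M m)⟩
  algebraMap_mem' r := ⟨⟨|r|, fun _ => le_rfl⟩, fun _ _ => A.alg.algebraMap_mem r⟩

/-- The restriction of an element of `fiberedAlg` to the fibre over `(M, m)`. -/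
def slice (M : ℕ) (m : ℤ) : A.fiberedAlg →ₐ[ℝ] A.alg where
  toFun F := ⟨fun x => F.1 (M, m, x), F.2.2 M m⟩
  map_one' := rfl
  map_mul' _ _ := rfl
  map_zero' := rfl
  map_add' _ _ := rfl
  commutes' _ := rfl

/-- The mean of `F` over the fibres `(M, 1), …, (M, M)`. -/
noncomputable def fiberMean (M : ℕ) : A.fiberedAlg →ₗ[ℝ] ℝ :=
  (M : ℝ)⁻¹ • ∑ m ∈ Finset.Icc 1 M, A.mean ∘ₗ (A.slice M (m : ℤ)).toLinearMap

theorem fiberMean_apply (M : ℕ) (F : A.fiberedAlg) :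
    A.fiberMean M F = (M : ℝ)⁻¹ * ∑ m ∈ Finset.Icc 1 M, A.mean (A.slice M (m : ℤ) F) := by
  simp [fiberMean]

theorem exists_tendsto_fiberMean (U : Ultrafilter ℕ) (F : A.fiberedAlg) :
    ∃ l, Tendsto (fun M => A.fiberMean M F) U (𝓝 l) := by
  obtain ⟨C, hC⟩ := F.2.1
  refine U.exists_tendsto_of_abs_le (C := |C| * A.mean 1) fun M => ?_
  rw [fiberMean_apply]
  refine abs_inv_mul_sum_Icc_le (mul_nonneg (abs_nonneg _) A.mean_one_nonneg) fun m _ => ?_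
  exact A.abs_mean_le fun x => (hC _).trans (le_abs_self _)

/-- The algebra of uniformly bounded families indexed by `ℕ × ℤ`, with the limit along an
ultrafilter of the fibre means. The group `G^ℤ` acts on it fibrewise. -/
noncomputable def fibered (U : Ultrafilter ℕ) : MeanAlgebra (GSequence G) (Fibered Ω) where
  alg := A.fiberedAlg
  bounded _ hF := hF.1
  smul_mem g F hF := by
    obtain ⟨⟨C, hC⟩, hF⟩ := hF
    exact ⟨⟨C, fun _ => hC _⟩, fun M m => A.smul_mem (g m) _ (hF M m)⟩
  mean :=
    { toFun := fun F => (A.exists_tendsto_fiberMean U F).choose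
      map_add' := fun F F' =>
        tendsto_nhds_unique (A.exists_tendsto_fiberMean U (F + F')).choose_spec <| by
          simpa only [map_add] using (A.exists_tendsto_fiberMean U F).choose_spec.add
            (A.exists_tendsto_fiberMean U F').choose_spec
      map_smul' := fun c F =>
        tendsto_nhds_unique (A.exists_tendsto_fiberMean U (c • F)).choose_spec <| by
          simpa only [map_smul, RingHom.id_apply, smul_eq_mul] using
            (A.exists_tendsto_fiberMean U F).choose_spec.const_mul c }
  mean_nonneg F hF := by
    refine ge_of_tendsto' (A.exists_tendsto_fiberMean U F).choose_spec fun M => ?_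
    rw [fiberMean_apply]
    have : ∀ m ∈ Finset.Icc 1 M, 0 ≤ A.mean (A.slice M (m : ℤ) F) := fun m _ =>
      A.mean_nonneg _ fun x => hF (M, (m : ℤ), x)
    have := Finset.sum_nonneg this
    positivity
  mean_smul g F := by
    refine tendsto_nhds_unique (A.exists_tendsto_fiberMean U _).choose_spec ?_
    refine (A.exists_tendsto_fiberMean U F).choose_spec.congr fun M => ?_
    rw [fiberMean_apply, fiberMean_apply]
    congr 1
    refine Finset.sum_congr rfl fun m _ => ?_
    exact (A.mean_translate (g m) (A.slice M (m : ℤ) F)).symm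

theorem tendsto_fiberMean (U : Ultrafilter ℕ) (F : (A.fibered U).alg) :
    Tendsto (fun M => A.fiberMean M F) U (𝓝 ((A.fibered U).mean F)) :=
  (A.exists_tendsto_fiberMean U F).choose_spec

/-- A uniformly bounded sequence in the algebra, as a family indexed by `ℕ × ℤ` which does not
depend on the second index. -/
def fiberedOfSeq (a : ℕ → A.alg) (ha : ∃ C, ∀ M x, |(a M).1 x| ≤ C) : A.fiberedAlg :=
  ⟨fun z => (a z.1).1 z.2.2, ha.imp fun _ hC _ => hC _ _, fun M _ => (a M).2⟩

/-- An element of the algebra, as a constant family. -/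
def fiberedConst (f : A.alg) : A.fiberedAlg :=
  A.fiberedOfSeq (fun _ => f) ((A.bounded f.1 f.2).imp fun _ hC _ x => hC x)

end Fibered

end MeanAlgebra

/-! ### Induction on complexity -/

theorem sum_Icc_shift_sub (w : ℤ → ℝ) (M : ℕ) (n : ℤ) :
    ∑ m ∈ Finset.Icc 1 M, w (n + m) - ∑ m ∈ Finset.Icc 1 M, w (n + 1 + m)
      = w (n + 1) - w (n + 1 + M) := by
  induction M with
  | zero => simp
  | succ M ih =>
    rw [Finset.sum_Icc_succ_top (by omega), Finset.sum_Icc_succ_top (by omega)]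
    push_cast
    rw [show n + ((M : ℤ) + 1) = n + 1 + M by ring]
    linarith

theorem abs_sum_Icc_sub_sum_Icc_shift_le {w : ℤ → ℝ} {K : ℝ} (h : ∀ m, |w m| ≤ K) (M n : ℕ) :
    |∑ m ∈ Finset.Icc 1 M, w m - ∑ m ∈ Finset.Icc 1 M, w (n + m)| ≤ 2 * n * K := by
  induction n with
  | zero => simp
  | succ n ih =>
    have hstep := sum_Icc_shift_sub w M n
    have h1 := abs_le.1 (h (n + 1))
    have h2 := abs_le.1 (h (n + 1 + M))
    rw [abs_le] at ih ⊢
    push_cast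
    constructor <;> linarith [h1.1, h1.2, h2.1, h2.2, ih.1, ih.2]

namespace MeanAlgebra

variable {G : Type*} [Group G] {Ω : Type*} [MulAction G Ω] (A : MeanAlgebra G Ω)

/-- All averages along the system `p` are Cauchy in the `L²` seminorm of the algebra. -/
def CauchyAverages {k : ℕ} (p : GSystem G k) : Prop :=
  ∀ f : Fin k → A.alg, ∀ ε > 0, ∃ N₀, ∀ N ≥ N₀, ∀ N' ≥ N₀,
    A.form (A.average p f N - A.average p f N') (A.average p f N - A.average p f N') ≤ ε

section Twisted

variable {k : ℕ} (p : GSystem G (k + 1)) (f : Fin k → A.alg)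

/-- The product `∏_{i<k} fᵢ ∘ pᵢ(n)` over all entries of the system but the last. -/
def initProd (n : ℤ) : A.alg := ∏ i : Fin k, A.translate (p i.castSucc n) (f i)

theorem exists_abs_initProd_le : ∃ C, 0 ≤ C ∧ ∀ n x, |(A.initProd p f n).1 x| ≤ C := by
  choose c hc using fun i => A.bounded (f i).1 (f i).2
  refine ⟨∏ i, |c i|, Finset.prod_nonneg fun i _ => abs_nonneg _, fun n x => ?_⟩
  rw [initProd, coe_prod_apply, Finset.abs_prod]
  exact Finset.prod_le_prod (fun i _ => abs_nonneg _)
    fun i _ => (hc i _).trans (le_abs_self _)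

/-- The averages of the system as an operator in the last function. -/
noncomputable def averageOp (N : ℕ) : A.alg →ₗ[ℝ] A.alg :=
  (N : ℝ)⁻¹ • ∑ n ∈ Finset.Icc 1 N, LinearMap.mulLeft ℝ (A.initProd p f (n : ℤ)) ∘ₗ
    (A.translate (p (Fin.last k) (n : ℤ))).toLinearMap

theorem averageOp_apply (N : ℕ) (u : A.alg) :
    A.averageOp p f N u = (N : ℝ)⁻¹ • ∑ n ∈ Finset.Icc 1 N,
      A.initProd p f n * A.translate (p (Fin.last k) n) u := by
  simp [averageOp]

/-- The adjoint of `averageOp`. -/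
noncomputable def averageAdj (N : ℕ) : A.alg →ₗ[ℝ] A.alg :=
  (N : ℝ)⁻¹ • ∑ n ∈ Finset.Icc 1 N, (A.translate (p (Fin.last k) (n : ℤ))⁻¹).toLinearMap ∘ₗ
    LinearMap.mulLeft ℝ (A.initProd p f (n : ℤ))

theorem averageAdj_apply (N : ℕ) (u : A.alg) :
    A.averageAdj p f N u = (N : ℝ)⁻¹ • ∑ n ∈ Finset.Icc 1 N,
      A.translate (p (Fin.last k) n)⁻¹ (A.initProd p f n * u) := by
  simp [averageAdj]

theorem average_eq_averageOp (f : Fin (k + 1) → A.alg) (N : ℕ) :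
    A.average p f N = A.averageOp p (fun i => f i.castSucc) N (f (Fin.last k)) := by
  simp only [average, averageOp_apply, initProd, Fin.prod_univ_castSucc]

theorem form_averageOp (N : ℕ) (u v : A.alg) :
    A.form (A.averageOp p f N u) v = A.form u (A.averageAdj p f N v) := by
  rw [averageOp_apply, averageAdj_apply]
  simp only [map_smul, map_sum, LinearMap.smul_apply, LinearMap.sum_apply]
  congr 1
  refine Finset.sum_congr rfl fun n _ => ?_
  rw [form_apply, form_apply, ← A.mean_translate (p (Fin.last k) n)⁻¹]
  congr 1
  simp only [map_mul, translate_translate, mul_inv_cancel, translate_one]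
  ring

theorem form_averageOp_self_le {C : ℝ} (h : ∀ n x, |(A.initProd p f n).1 x| ≤ C)
    (N : ℕ) (u : A.alg) :
    A.form (A.averageOp p f N u) (A.averageOp p f N u) ≤ C ^ 2 * A.form u u := by
  rw [averageOp_apply]
  refine (A.form_average_self_le N _).trans ?_
  have hu := A.form_self_nonneg u
  refine (le_abs_self _).trans (abs_inv_mul_sum_Icc_le (by positivity) fun n _ => ?_)
  rw [abs_of_nonneg (A.form_self_nonneg _)]
  refine (A.form_mul_self_le (h n) _).trans_eq ?_
  rw [form_translate_self]

theorem exists_abs_averageOp_le (u : A.alg) :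
    ∃ C, 0 ≤ C ∧ ∀ N x, |(A.averageOp p f N u).1 x| ≤ C := by
  obtain ⟨C, hC, hP⟩ := A.exists_abs_initProd_le p f
  obtain ⟨c, hc⟩ := A.bounded u.1 u.2
  refine ⟨C * |c|, by positivity, fun N x => ?_⟩
  rw [averageOp_apply]
  have : ((N : ℝ)⁻¹ • ∑ n ∈ Finset.Icc 1 N,
      A.initProd p f n * A.translate (p (Fin.last k) n) u).1 x
      = (N : ℝ)⁻¹ * ∑ n ∈ Finset.Icc 1 N,
        (A.initProd p f n).1 x * u.1 (p (Fin.last k) n • x) := by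
    simp
  rw [this]
  refine abs_inv_mul_sum_Icc_le (by positivity) fun n _ => ?_
  rw [abs_mul]
  exact mul_le_mul (hP _ _) ((hc _).trans (le_abs_self _)) (abs_nonneg _) hC

/-- The functions whose averages along the reduction of the system approximate
`averageOp N (averageAdj M (a M))`. -/
def reductionFun (a : ℕ → A.alg) (ha : ∃ C, ∀ M x, |(a M).1 x| ≤ C) :
    Fin (k + (k + 1)) → A.fiberedAlg :=
  Fin.append (fun i => A.fiberedConst (f i))
    (Fin.cons (A.fiberedOfSeq a ha) fun i => A.fiberedConst (f i))

theorem slice_average_reduction (U : Ultrafilter ℕ) (a : ℕ → A.alg)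
    (ha : ∃ C, ∀ M x, |(a M).1 x| ≤ C) (N M : ℕ) (m : ℤ) :
    A.slice M m ((A.fibered U).average (GSystem.reduction p) (A.reductionFun f a ha) N)
      = (N : ℝ)⁻¹ • ∑ n ∈ Finset.Icc 1 N, A.initProd p f n *
        A.translate ((p (Fin.last k) (n + m))⁻¹ * p (Fin.last k) n)
          (A.initProd p f (n + m) * a M) := by
  have hslice : ∀ (g : GSequence G) (F : A.fiberedAlg),
      A.slice M m ((A.fibered U).translate g F) = A.translate (g m) (A.slice M m F) :=
    fun _ _ => rfl
  have hconst : ∀ g : A.alg, A.slice M m (A.fiberedConst g) = g := fun _ => rfl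
  have hseq : A.slice M m (A.fiberedOfSeq a ha) = a M := rfl
  unfold average
  refine (map_smul (A.slice M m) _ _).trans ?_
  congr 1
  refine (map_sum (A.slice M m) _ _).trans ?_
  refine Finset.sum_congr rfl fun n _ => ?_
  refine (map_prod (A.slice M m) _ _).trans ?_
  rw [Fin.prod_univ_add]
  simp only [hslice, GSystem.reduction, reductionFun, Fin.append_left, Fin.append_right,
    Fin.prod_univ_succ, Fin.cons_zero, Fin.cons_succ, hconst, hseq]
  simp only [initProd, map_mul, map_prod, translate_translate, GSequence.bracket, GSequence.diff,
    GSequence.const, Pi.one_apply, one_mul]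
  rw [mul_comm (∏ i : Fin k, A.translate (p i.castSucc (n + m) * _) (f i))]

/-- A structured function `averageAdj M b` is itself an average over `m ≤ M`, so that shifting `m`
by `n` turns `p_k(m)⁻¹ p_k(n)` into the entries of the reduction at a cost of `O(n / M)`. -/
theorem abs_averageOp_averageAdj_sub_le {C K : ℝ} (hC : 0 ≤ C) (hK : 0 ≤ K)
    (hP : ∀ n x, |(A.initProd p f n).1 x| ≤ C)
    (U : Ultrafilter ℕ) (a : ℕ → A.alg) (ha : ∀ M x, |(a M).1 x| ≤ K) (N M : ℕ) (x : Ω) :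
    |(A.averageOp p f N (A.averageAdj p f M (a M)) - (M : ℝ)⁻¹ • ∑ m ∈ Finset.Icc 1 M,
      A.slice M (m : ℤ) ((A.fibered U).average (GSystem.reduction p)
        (A.reductionFun f a ⟨K, ha⟩) N)).1 x| ≤ C * (2 * N * (C * K)) * (M : ℝ)⁻¹ := by
  let W : ℤ → ℤ → A.alg := fun n m =>
    A.translate ((p (Fin.last k) m)⁻¹ * p (Fin.last k) n) (A.initProd p f m * a M)
  have hW : ∀ n m, |(W n m).1 x| ≤ C * K := fun n m => by
    simp only [W, translate_apply, Subalgebra.coe_mul, Pi.mul_apply, abs_mul]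
    exact mul_le_mul (hP _ _) (ha _ _) (abs_nonneg _) hC
  have h1 : A.averageOp p f N (A.averageAdj p f M (a M))
      = (N : ℝ)⁻¹ • ∑ n ∈ Finset.Icc 1 N, A.initProd p f n *
        ((M : ℝ)⁻¹ • ∑ m ∈ Finset.Icc 1 M, W n m) := by
    rw [averageOp_apply, averageAdj_apply]
    simp only [map_smul, map_sum, translate_translate, W]
  have h2 : (M : ℝ)⁻¹ • ∑ m ∈ Finset.Icc 1 M,
      A.slice M (m : ℤ) ((A.fibered U).average (GSystem.reduction p)
        (A.reductionFun f a ⟨K, ha⟩) N)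
      = (N : ℝ)⁻¹ • ∑ n ∈ Finset.Icc 1 N, A.initProd p f n *
        ((M : ℝ)⁻¹ • ∑ m ∈ Finset.Icc 1 M, W n (n + m)) := by
    simp only [slice_average_reduction, W, Finset.smul_sum, Finset.mul_sum, mul_smul_comm]
    rw [Finset.sum_comm]
    refine Finset.sum_congr rfl fun n _ => Finset.sum_congr rfl fun m _ => ?_
    rw [smul_comm]
  have h3 : (A.averageOp p f N (A.averageAdj p f M (a M)) - (M : ℝ)⁻¹ • ∑ m ∈ Finset.Icc 1 M,
      A.slice M (m : ℤ) ((A.fibered U).average (GSystem.reduction p)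
        (A.reductionFun f a ⟨K, ha⟩) N)).1 x
      = (N : ℝ)⁻¹ * ∑ n ∈ Finset.Icc 1 N, (A.initProd p f n).1 x * ((M : ℝ)⁻¹ *
        (∑ m ∈ Finset.Icc 1 M, (W n m).1 x - ∑ m ∈ Finset.Icc 1 M, (W n (n + m)).1 x)) := by
    rw [h1, h2, ← smul_sub, ← Finset.sum_sub_distrib]
    simp only [← mul_sub, ← smul_sub, Subalgebra.coe_smul, Pi.smul_apply, smul_eq_mul,
      coe_sum_apply, Subalgebra.coe_mul, Pi.mul_apply, AddSubgroupClass.coe_sub, Pi.sub_apply]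
  rw [h3]
  refine abs_inv_mul_sum_Icc_le (by positivity) fun n hn => ?_
  have hnN : (n : ℝ) ≤ N := by exact_mod_cast (Finset.mem_Icc.1 hn).2
  have h4 := abs_sum_Icc_sub_sum_Icc_shift_le (w := fun m => (W n m).1 x) (hW n) M n
  rw [abs_mul, abs_mul, abs_of_nonneg (by positivity : (0 : ℝ) ≤ (M : ℝ)⁻¹), mul_assoc,
    mul_comm (2 * (N : ℝ) * (C * K))]
  refine mul_le_mul (hP _ _) (mul_le_mul_of_nonneg_left (h4.trans ?_) (by positivity))
    (by positivity) hC
  gcongr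

end Twisted

theorem cauchyAverages_of_reduction {k : ℕ} (p : GSystem G (k + 1))
    (h : ∀ U : Ultrafilter ℕ, (A.fibered U).CauchyAverages (GSystem.reduction p)) :
    A.CauchyAverages p := by
  intro f
  set f' : Fin k → A.alg := fun i => f i.castSucc
  obtain ⟨C, hC, hP⟩ := A.exists_abs_initProd_le p f'
  simp only [average_eq_averageOp]
  refine cauchy_of_adjoint_comp A.form
    (fun u v => by rw [form_apply, form_apply, mul_comm]) A.form_self_nonneg
    (A.averageOp p f') (A.averageAdj p f') (A.form_averageOp p f') hC
    (A.form_averageOp_self_le p f' hP) ?_ _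
  intro U hU u ε hε
  obtain ⟨K, hK, ha⟩ := A.exists_abs_averageOp_le p f' u
  set a : ℕ → A.alg := fun M => A.averageOp p f' M u
  set R := (A.fibered U).average (GSystem.reduction p) (A.reductionFun f' a ⟨K, ha⟩)
  obtain ⟨N₀, hN₀⟩ := h U (A.reductionFun f' a ⟨K, ha⟩) (ε / 8) (by positivity)
  refine ⟨N₀, fun N hN N' hN' => ?_⟩
  -- the main term: the mean over the fibres of the difference of averages along the reduction
  have hmain : ∀ᶠ M in (U : Filter ℕ),
      A.fiberMean M ((R N - R N') * (R N - R N')) < ε / 4 :=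
    (A.tendsto_fiberMean U ((R N - R N') * (R N - R N'))).eventually_lt_const
      ((hN₀ N hN N' hN').trans_lt (by linarith))
  have herr : ∀ᶠ M : ℕ in (U : Filter ℕ),
      ((C * (2 * N * (C * K)) + C * (2 * N' * (C * K))) * (M : ℝ)⁻¹) ^ 2 * A.mean 1 < ε / 4 := by
    have h0 := (((tendsto_inv_atTop_nhds_zero_nat (𝕜 := ℝ)).const_mul
      (C * (2 * N * (C * K)) + C * (2 * N' * (C * K)))).pow 2).mul_const (A.mean 1)
    refine (h0.mono_left hU).eventually_lt_const ?_
    simp only [mul_zero, ne_eq, OfNat.ofNat_ne_zero, not_false_eq_true, zero_pow, zero_mul]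
    positivity
  filter_upwards [hmain, herr] with M hM hM'
  set Θ : ℕ → A.alg := fun N => (M : ℝ)⁻¹ • ∑ m ∈ Finset.Icc 1 M, A.slice M (m : ℤ) (R N) with hΘ
  set e : ℕ → A.alg := fun N => A.averageOp p f' N (A.averageAdj p f' M (a M)) - Θ N with he
  have hbound : ∀ N x, |(e N).1 x| ≤ C * (2 * N * (C * K)) * (M : ℝ)⁻¹ := fun N x =>
    A.abs_averageOp_averageAdj_sub_le p f' hC hK hP U a ha N M x
  have hsplit : (A.averageOp p f' N - A.averageOp p f' N') (A.averageAdj p f' M (a M))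
      = (e N - e N') + (Θ N - Θ N') := by
    rw [LinearMap.sub_apply]
    simp only [he]
    abel
  have hΘ' : Θ N - Θ N' = (M : ℝ)⁻¹ • ∑ m ∈ Finset.Icc 1 M, A.slice M (m : ℤ) (R N - R N') := by
    rw [hΘ]
    simp only [← smul_sub, ← Finset.sum_sub_distrib]
    rfl
  have hQΘ : A.form (Θ N - Θ N') (Θ N - Θ N') ≤ ε / 4 := by
    rw [hΘ']
    exact (A.form_average_self_le M _).trans
      ((A.fiberMean_apply M ((R N - R N') * (R N - R N'))).symm.trans_le hM.le)
  have hQe : A.form (e N - e N') (e N - e N') ≤ ε / 4 := by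
    refine (A.form_self_le (C := (C * (2 * N * (C * K)) + C * (2 * N' * (C * K))) * (M : ℝ)⁻¹)
      fun x => ?_).trans hM'.le
    rw [add_mul]
    exact (abs_sub _ _).trans (add_le_add (hbound N x) (hbound N' x))
  rw [hsplit]
  linarith [A.form_add_self_le (e N - e N') (Θ N - Θ N')]

theorem cauchyAverages_of_isTrivial {k : ℕ} {p : GSystem G k} (hp : GSystem.IsTrivial p) :
    A.CauchyAverages p := by
  intro f ε hε
  choose g hg using hp
  have h : ∀ N ≥ 1, A.average p f N = ∏ i, A.translate (g i) (f i) := fun N hN => by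
    have hN' : (N : ℝ) ≠ 0 := by positivity
    simp only [average, hg, GSequence.const, Finset.sum_const, Nat.card_Icc, Nat.add_sub_cancel]
    rw [← Nat.cast_smul_eq_nsmul ℝ, inv_smul_smul₀ hN']
  refine ⟨1, fun N hN N' hN' => ?_⟩
  rw [h N hN, h N' hN', sub_self, map_zero]
  exact hε.le

theorem cauchyAverages_of_reorder {k : ℕ} {p : GSystem G k} (σ : Equiv.Perm (Fin k))
    (h : A.CauchyAverages fun i => p (σ i)) : A.CauchyAverages p := by
  intro f
  have h' := h fun i => f (σ i)
  have heq : A.average (fun i => p (σ i)) (fun i => f (σ i)) = A.average p f := by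
    funext N
    unfold average
    congr 1
    exact Finset.sum_congr rfl fun n _ =>
      Equiv.prod_comp σ fun i => A.translate (p i n) (f i)
  rwa [heq] at h'

theorem cauchyAverages_of_removeDuplicate {k : ℕ} {p : GSystem G (k + 1)} {i j : Fin (k + 1)}
    (hij : i ≠ j) (hp : p i = p j) (h : A.CauchyAverages fun l : Fin k => p (j.succAbove l)) :
    A.CauchyAverages p := by
  intro f
  obtain ⟨i, rfl⟩ := Fin.exists_succAbove_eq hij
  have h' := h fun l => f (j.succAbove l) * if l = i then f j else 1
  have heq : A.average (fun l : Fin k => p (j.succAbove l))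
      (fun l => f (j.succAbove l) * if l = i then f j else 1) = A.average p f := by
    funext N
    unfold average
    congr 1
    refine Finset.sum_congr rfl fun n _ => ?_
    have hi : ∏ l : Fin k, A.translate (p (j.succAbove l) n) (if l = i then f j else 1)
        = A.translate (p j n) (f j) := by
      rw [Finset.prod_eq_single i (fun l _ hl => by simp [hl]) (by simp), if_pos rfl, hp]
    rw [Fin.prod_univ_succAbove _ j]
    simp only [map_mul, Finset.prod_mul_distrib]
    rw [hi, mul_comm]
  rwa [heq] at h'

end MeanAlgebra

/-- Since the functional of a `MeanAlgebra` need not come from a measure, the induction on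
complexity can stay inside this class of systems: a reduction replaces the group `G` by `G^ℤ` and
the algebra by its `fibered` version. -/
theorem GSystem.FiniteComplexity.cauchyAverages {G : Type u} [Group G] {k : ℕ} {p : GSystem G k}
    (hp : FiniteComplexity p) {Ω : Type*} [MulAction G Ω] (A : MeanAlgebra G Ω) :
    A.CauchyAverages p := by
  induction hp generalizing Ω with
  | trivial p hp => exact A.cauchyAverages_of_isTrivial hp
  | reorder p σ _ ih => exact A.cauchyAverages_of_reorder σ (ih A)
  | removeDuplicate p i j hij hp _ ih => exact A.cauchyAverages_of_removeDuplicate hij hp (ih A)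
  | reduce p _ ih => exact A.cauchyAverages_of_reduction p fun U => ih (A.fibered U)

/-! ### Averages in `L²` of an invariant measure -/

section Measure

variable {X : Type*} [MeasurableSpace X] (μ : Measure X)

/-- The bounded measurable functions with integration against a finite invariant measure. -/
noncomputable def MeanAlgebra.ofMeasure [IsFiniteMeasure μ] (G : Type*) [Group G] [MulAction G X]
    [MeasurableConstSMul G X] [SMulInvariantMeasure G X μ] : MeanAlgebra G X where
  alg :=
    { carrier := {f | Measurable f ∧ ∃ C, ∀ x, |f x| ≤ C}
      mul_mem' := by
        rintro f g ⟨hf, C, hC⟩ ⟨hg, C', hC'⟩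
        refine ⟨hf.mul hg, C * C', fun z => ?_⟩
        rw [Pi.mul_apply, abs_mul]
        exact mul_le_mul (hC z) (hC' z) (abs_nonneg _) ((abs_nonneg _).trans (hC z))
      add_mem' := by
        rintro f g ⟨hf, C, hC⟩ ⟨hg, C', hC'⟩
        exact ⟨hf.add hg, C + C', fun z => (abs_add_le _ _).trans (add_le_add (hC z) (hC' z))⟩
      algebraMap_mem' := fun r => ⟨measurable_const, |r|, fun _ => le_rfl⟩ }
  bounded _ hf := hf.2
  smul_mem g f hf := ⟨hf.1.comp (measurable_const_smul g), hf.2.imp fun _ hC _ => hC _⟩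
  mean :=
    have hint : ∀ f : X → ℝ, (Measurable f ∧ ∃ C, ∀ x, |f x| ≤ C) → Integrable f μ :=
      fun f hf => Integrable.of_bound hf.1.aestronglyMeasurable hf.2.choose
        (Eventually.of_forall hf.2.choose_spec)
    { toFun := fun f => ∫ x, f.1 x ∂μ
      map_add' := fun f g => integral_add (hint f.1 f.2) (hint g.1 g.2)
      map_smul' := fun c f => integral_const_mul c f.1 }
  mean_nonneg _ hf := integral_nonneg hf
  mean_smul g f := (measurePreserving_smul g μ).integral_comp
    (MeasurableEquiv.smul g).measurableEmbedding f.1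

theorem exists_tendsto_eLpNorm_of_cauchy {a : ℕ → X → ℝ} (ha : ∀ N, MemLp (a N) 2 μ)
    (h : ∀ ε > 0, ∃ N₀, ∀ N ≥ N₀, ∀ N' ≥ N₀, ∫ x, (a N x - a N' x) * (a N x - a N' x) ∂μ ≤ ε) :
    ∃ F, MemLp F 2 μ ∧ Tendsto (fun N => eLpNorm (a N - F) 2 μ) atTop (𝓝 0) := by
  have hsq : ∀ N N', ‖(ha N).toLp - (ha N').toLp‖ ^ 2
      = ∫ x, (a N x - a N' x) * (a N x - a N' x) ∂μ := fun N N' => by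
    rw [← real_inner_self_eq_norm_sq, L2.inner_def]
    refine integral_congr_ae ?_
    filter_upwards [Lp.coeFn_sub (ha N).toLp (ha N').toLp, (ha N).coeFn_toLp,
      (ha N').coeFn_toLp] with x h1 h2 h3
    rw [h1, Pi.sub_apply, h2, h3]
    rfl
  have hc : CauchySeq fun N => (ha N).toLp := by
    refine Metric.cauchySeq_iff.2 fun ε hε => ?_
    obtain ⟨N₀, hN₀⟩ := h ((ε / 2) ^ 2) (by positivity)
    refine ⟨N₀, fun N hN N' hN' => ?_⟩
    have h1 := hN₀ N hN N' hN'
    rw [← hsq] at h1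
    rw [dist_eq_norm]
    exact (le_of_sq_le_sq h1 (by positivity)).trans_lt (by linarith)
  obtain ⟨F, hF⟩ := cauchySeq_tendsto_of_complete hc
  refine ⟨F, Lp.memLp F, ?_⟩
  have h2 := (Lp.tendsto_Lp_iff_tendsto_eLpNorm' _ _).1 hF
  refine h2.congr fun N => eLpNorm_congr_ae ?_
  exact (ha N).coeFn_toLp.sub EventuallyEq.rfl

theorem MeasureTheory.MemLp.exists_measurable_bounded {𝕜 : Type*} [RCLike 𝕜] {f : X → 𝕜}
    (hf : MemLp f ∞ μ) : ∃ f', Measurable f' ∧ (∃ C, ∀ x, ‖f' x‖ ≤ C) ∧ f =ᵐ[μ] f' := by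
  have hC := ae_le_lpNorm_exponent_top hf
  set C := lpNorm f ∞ μ
  set g := hf.1.mk f with hg
  have hgm : Measurable g := hf.1.stronglyMeasurable_mk.measurable
  refine ⟨{x | ‖g x‖ ≤ C}.indicator g,
    hgm.indicator (measurableSet_le hgm.norm measurable_const), ⟨|C|, fun x => ?_⟩, ?_⟩
  · by_cases hx : ‖g x‖ ≤ C
    · rw [Set.indicator_of_mem (show x ∈ {x | ‖g x‖ ≤ C} from hx)]
      exact hx.trans (le_abs_self C)
    · rw [Set.indicator_of_notMem (show x ∉ {x | ‖g x‖ ≤ C} from hx), norm_zero]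
      exact abs_nonneg C
  · filter_upwards [hC, hf.1.ae_eq_mk] with x hx hxg
    have hx' : x ∈ {x | ‖g x‖ ≤ C} := by
      change ‖g x‖ ≤ C
      rwa [hg, ← hxg]
    rw [Set.indicator_of_mem hx', hxg]

theorem exists_tendsto_average_real {G : Type*} [Group G] [IsFiniteMeasure μ]
    [MulAction G X] [MeasurableConstSMul G X] [SMulInvariantMeasure G X μ]
    {k : ℕ} {p : GSystem G k} (hp : GSystem.FiniteComplexity p)
    {f : Fin k → X → ℝ} (hf : ∀ i, Measurable (f i)) (hb : ∀ i, ∃ C, ∀ x, |f i x| ≤ C) :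
    ∃ F : X → ℝ, MemLp F 2 μ ∧ Tendsto (fun N : ℕ => eLpNorm
      ((fun x => (N : ℝ)⁻¹ * ∑ n ∈ Finset.Icc 1 N, ∏ i, f i (p i (n : ℤ) • x)) - F) 2 μ)
        atTop (𝓝 0) := by
  set A := MeanAlgebra.ofMeasure μ G
  set f' : Fin k → A.alg := fun i => ⟨f i, hf i, hb i⟩
  have hmem : ∀ u : A.alg, MemLp u.1 2 μ := fun u =>
    MemLp.of_bound u.2.1.aestronglyMeasurable u.2.2.choose
      (Eventually.of_forall u.2.2.choose_spec)
  have hc := hp.cauchyAverages A f'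
  have hav : ∀ N, (A.average p f' N).1
      = fun x => (N : ℝ)⁻¹ * ∑ n ∈ Finset.Icc 1 N, ∏ i, f i (p i (n : ℤ) • x) := fun N =>
    funext fun x => A.average_apply p f' N x
  obtain ⟨F, hF, hlim⟩ := exists_tendsto_eLpNorm_of_cauchy μ
    (a := fun N => (A.average p f' N).1) (fun N => hmem _) hc
  simp only [hav] at hlim
  exact ⟨F, hF, hlim⟩

theorem exists_tendsto_average_of_measurable {𝕜 : Type*} [RCLike 𝕜] {G : Type*} [Group G]
    [IsFiniteMeasure μ] [MulAction G X] [MeasurableConstSMul G X] [SMulInvariantMeasure G X μ]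
    {k : ℕ} {p : GSystem G k} (hp : GSystem.FiniteComplexity p)
    {f : Fin k → X → 𝕜} (hf : ∀ i, Measurable (f i)) (hb : ∀ i, ∃ C, ∀ x, ‖f i x‖ ≤ C) :
    ∃ F : X → 𝕜, MemLp F 2 μ ∧ Tendsto (fun N : ℕ => eLpNorm
      (fun x => (N : 𝕜)⁻¹ * ∑ n ∈ Finset.Icc 1 N, ∏ i, f i (p i (n : ℤ) • x) - F x) 2 μ)
        atTop (𝓝 0) := by
  -- expand each product into the real and imaginary parts of its factors
  let part : Bool → 𝕜 → ℝ := fun b z => if b then RCLike.re z else RCLike.im z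
  let unit : Bool → 𝕜 := fun b => if b then 1 else RCLike.I
  have hpart : ∀ z : 𝕜, z = ∑ b, unit b * (part b z : 𝕜) := fun z => by
    have := RCLike.re_add_im z
    simp only [Fintype.sum_bool, unit, part]
    simp only [if_true, Bool.false_eq_true, if_false, one_mul]
    rw [mul_comm, this]
  have hreal : ∀ s : Fin k → Bool, ∃ F : X → ℝ, MemLp F 2 μ ∧ Tendsto (fun N : ℕ => eLpNorm
      ((fun x => (N : ℝ)⁻¹ * ∑ n ∈ Finset.Icc 1 N, ∏ i, part (s i) (f i (p i (n : ℤ) • x))) - F)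
        2 μ) atTop (𝓝 0) := fun s =>
    exists_tendsto_average_real μ hp (f := fun i x => part (s i) (f i x))
      (fun i => by
        cases s i
        · exact RCLike.measurable_im.comp (hf i)
        · exact RCLike.measurable_re.comp (hf i))
      (fun i => (hb i).imp fun C hC x => by
        cases s i
        · exact (RCLike.abs_im_le_norm _).trans (hC x)
        · exact (RCLike.abs_re_le_norm _).trans (hC x))
  choose F hF hlim using hreal
  let c : (Fin k → Bool) → 𝕜 := fun s => ∏ i, unit (s i)
  refine ⟨fun x => ∑ s, c s * (F s x : 𝕜),
    memLp_finsetSum _ fun s _ => ((hF s).ofReal (K := 𝕜)).const_mul (c s), ?_⟩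
  have hexp : ∀ N : ℕ, (fun x => (N : 𝕜)⁻¹ * ∑ n ∈ Finset.Icc 1 N, ∏ i, f i (p i (n : ℤ) • x)
      - ∑ s, c s * (F s x : 𝕜)) = ∑ s, c s • fun x => (((fun x => (N : ℝ)⁻¹ *
        ∑ n ∈ Finset.Icc 1 N, ∏ i, part (s i) (f i (p i (n : ℤ) • x))) - F s) x : 𝕜) := by
    intro N
    funext x
    have h1 : ∀ n : ℕ, ∏ i, f i (p i (n : ℤ) • x)
        = ∑ s : Fin k → Bool, c s * ((∏ i, part (s i) (f i (p i (n : ℤ) • x)) : ℝ) : 𝕜) := by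
      intro n
      conv_lhs => enter [2, i]; rw [hpart (f i (p i (n : ℤ) • x))]
      rw [Fintype.prod_sum]
      refine Finset.sum_congr rfl fun s _ => ?_
      rw [Finset.prod_mul_distrib, RCLike.ofReal_prod]
    simp only [h1, Finset.sum_apply, Pi.smul_apply, Pi.sub_apply, smul_eq_mul, RCLike.ofReal_sub,
      mul_sub, Finset.sum_sub_distrib]
    congr 1
    rw [Finset.sum_comm, Finset.mul_sum]
    refine Finset.sum_congr rfl fun s _ => ?_
    push_cast
    simp only [Finset.mul_sum]
    refine Finset.sum_congr rfl fun n _ => ?_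
    ring
  have hmeas : ∀ (N : ℕ) s, AEStronglyMeasurable (fun x => (((fun x => (N : ℝ)⁻¹ *
        ∑ n ∈ Finset.Icc 1 N, ∏ i, part (s i) (f i (p i (n : ℤ) • x))) - F s) x : 𝕜)) μ := by
    intro N s
    refine RCLike.continuous_ofReal.comp_aestronglyMeasurable (AEStronglyMeasurable.sub ?_ (hF s).1)
    refine Measurable.aestronglyMeasurable (measurable_const.mul ?_)
    refine Finset.measurable_fun_sum _ fun n _ => Finset.measurable_fun_prod _ fun i _ => ?_
    have h1 := (hf i).comp (measurable_const_smul (p i (n : ℤ)))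
    cases s i
    · exact RCLike.measurable_im.comp h1
    · exact RCLike.measurable_re.comp h1
  have hsum : Tendsto (fun N : ℕ => ∑ s, ‖c s‖ₑ * eLpNorm
      ((fun x => (N : ℝ)⁻¹ * ∑ n ∈ Finset.Icc 1 N, ∏ i, part (s i) (f i (p i (n : ℤ) • x))) - F s)
        2 μ) atTop (𝓝 0) := by
    have := tendsto_finsetSum Finset.univ fun s _ =>
      ENNReal.Tendsto.const_mul (hlim s) (Or.inr (enorm_ne_top (x := c s)))
    simpa only [mul_zero, Finset.sum_const_zero] using this
  refine tendsto_of_tendsto_of_tendsto_of_le_of_le tendsto_const_nhds hsum (fun _ => zero_le)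
    fun N => ?_
  rw [hexp]
  refine (eLpNorm_sum_le (fun s _ => (hmeas N s).const_smul (c s)) one_le_two).trans ?_
  refine Finset.sum_le_sum fun s _ => ?_
  rw [eLpNorm_const_smul]
  gcongr
  refine (eLpNorm_congr_norm_ae (Eventually.of_forall fun x => ?_)).le
  exact RCLike.norm_ofReal _

end Measure

theorem theorem2 {𝕜 : Type*} [RCLike 𝕜]
    {G : Type*} [Group G] [Countable G]
    {X : Type*} [MetricSpace X] [CompactSpace X] [MeasurableSpace X] [BorelSpace X]
    (μ : Measure X) [IsProbabilityMeasure μ]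
    [MulAction G X] [ContinuousConstSMul G X] [SMulInvariantMeasure G X μ]
    {k : ℕ} (p : GSystem G k) (hp : GSystem.FiniteComplexity p)
    (f : Fin k → X → 𝕜) (hf : ∀ i, MemLp (f i) ∞ μ) :
    ∃ F : X → 𝕜, MemLp F 2 μ ∧
      Tendsto
        (fun N : ℕ => eLpNorm
          (fun x => ((N : 𝕜)⁻¹ * ∑ n ∈ Finset.Icc 1 N, ∏ i, f i (p i (n : ℤ) • x)) - F x) 2 μ)
        atTop (𝓝 0) := by
  choose f' hf' hb heq using fun i => (hf i).exists_measurable_bounded μ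
  obtain ⟨F, hF, hlim⟩ := exists_tendsto_average_of_measurable μ hp hf' hb
  refine ⟨F, hF, hlim.congr fun N => eLpNorm_congr_ae ?_⟩
  have h : ∀ᵐ x ∂μ, ∀ (n : ℕ) i, f i (p i (n : ℤ) • x) = f' i (p i (n : ℤ) • x) :=
    ae_all_iff.2 fun n => ae_all_iff.2 fun i =>
      (measurePreserving_smul (p i (n : ℤ)) μ).quasiMeasurePreserving.ae (heq i)
  filter_upwards [h] with x hx
  simp only [hx]
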